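/- **Theorem 2.3 (Comparison Theorem).** Let $n\ge 2$, write points of $\mathbb R\times\mathbb R^{n-1}\times\mathbb R$ as $(s,y,\tau)$, and let $T^n$ be the unit period cell of $(y,\tau)$; functions on $T^n$ (or on $\mathbb R\times T^n$) are functions with period $1$ in each coordinate of $y$ and in $\tau$. Let $f\in C^1([0,1])$ be a combustion nonlinearity: for some $\theta\in(0,1)$, $f=0$ on $[0,\theta]$, $f>0$ on $(\theta,1)$, $f(1)=0$, and $f'(1)<0$. Let $\beta,\bar\beta:T^n\to\mathbb R$ be smooth with $\bar\beta\ge\beta$ everywhere. Let $u,\bar u:\mathbb R\times T^n\to[0,1]$ be of class $C^{2,1}_{(s,y),\tau}$ (the derivatives in $(s,y)$ up to order two and the first derivative in $\tau$ exist and are continuous) and satisfy $$\Delta_{s,y}u+\beta(y,\tau)\,u_s-u_\tau+f(u)\ge 0,\qquad \Delta_{s,y}\bar u+\bar\beta(y,\tau)\,\bar u_s-\bar u_\tau+f(\bar u)\le 0$$ on $\mathbb R\times T^n$, together with $$\lim_{s\to-\infty}u=\lim_{s\to-\infty}\bar u=0,\qquad \lim_{s\to+\infty}u=\lim_{s\to+\infty}\bar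 u=1,$$ uniformly in $(y,\tau)$. Assume in addition that at least one of the following holds: $\bar\beta\equiv\beta$; or $\bar u_s>0$ everywhere; or $u_s>0$ everywhere. Then there exists $\lambda\in\mathbb R$ such that $u(s,y,\tau)=\bar u(s+\lambda,y,\tau)$ for all $(s,y,\tau)$, and there exists a point $(y_0,\tau_0)\in T^n$ with $\bar\beta(y_0,\tau_0)=\beta(y_0,\tau_0)$. -/

import Mathlib

open Set Filter Topology
open scoped ContDiff

noncomputable section

namespace ShearFront

/-- The transversal space `ℝ^(n-1)` in which `y` lives, with its Euclidean norm. -/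
abbrev Transversal (n : ℕ) : Type := EuclideanSpace ℝ (Fin (n - 1))

/-- Combustion type nonlinearity `f ∈ C¹([0,1])` with ignition cut-off: for some `θ ∈ (0,1)`,
`f = 0` on `[0,θ]`, `f > 0` on `(θ,1)`, `f(1) = 0` and `f'(1) < 0` (one-sided derivative).
Only the values of `f` on `[0,1]` matter. -/
structure IsCombustion (f : ℝ → ℝ) : Prop where
  contDiffOn : ContDiffOn ℝ 1 f (Icc 0 1)
  cutoff : ∃ θ ∈ Ioo (0 : ℝ) 1, (∀ v ∈ Icc 0 θ, f v = 0) ∧ ∀ v ∈ Ioo θ 1, 0 < f v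
  one : f 1 = 0
  deriv_one : derivWithin f (Icc 0 1) 1 < 0

/-- `g(y,τ)` has period one in each coordinate of `y` and in `τ`, that is, `g` is a function on
the torus `T^n = ℝ^n / ℤ^n`. -/
structure IsPeriodic {n : ℕ} (g : Transversal n → ℝ → ℝ) : Prop where
  space : ∀ y τ i, g (y + EuclideanSpace.single i 1) τ = g y τ
  time : ∀ y τ, g y (τ + 1) = g y τ

/-- `u(s,y,τ)` is of class `C^{2,1}_{(s,y),τ}`: it is twice differentiable in `(s,y)` and once in
`τ`, and `u`, its `(s,y)`-derivatives up to order two, and `u_τ` are jointly continuous. -/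
structure IsC21 {n : ℕ} (u : ℝ → Transversal n → ℝ → ℝ) : Prop where
  contDiff_space : ∀ τ, ContDiff ℝ 2 (fun x : ℝ × Transversal n => u x.1 x.2 τ)
  continuous_space : ∀ k ≤ 2, Continuous (fun p : (ℝ × Transversal n) × ℝ =>
    iteratedFDeriv ℝ k (fun x : ℝ × Transversal n => u x.1 x.2 p.2) p.1)
  differentiable_time : ∀ s y, Differentiable ℝ (u s y)
  continuous_time : Continuous (fun p : (ℝ × Transversal n) × ℝ => deriv (u p.1.1 p.1.2) p.2)

/-- The partial derivative `u_s(s,y,τ)`. -/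
def dS {n : ℕ} (u : ℝ → Transversal n → ℝ → ℝ) (s : ℝ) (y : Transversal n) (τ : ℝ) : ℝ :=
  deriv (fun r => u r y τ) s

/-- The operator `L u = Δ_{s,y} u + β(y,τ) u_s - u_τ`, where `Δ_{s,y} u = u_ss + Δ_y u`. -/
def frontOp {n : ℕ} (β : Transversal n → ℝ → ℝ) (u : ℝ → Transversal n → ℝ → ℝ)
    (s : ℝ) (y : Transversal n) (τ : ℝ) : ℝ :=
  iteratedDeriv 2 (fun r => u r y τ) s + Laplacian.laplacian (fun z => u s z τ) y
    + β y τ * dS u s y τ - deriv (u s y) τ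

/-- The class of functions compared: `u ∈ C^{2,1}(ℝ × T^n)` with values in the domain `[0,1]` of
the nonlinearity, tending to `0` as `s → -∞` and to `1` as `s → +∞`, uniformly in `(y,τ)`. -/
structure IsFrontProfile {n : ℕ} (u : ℝ → Transversal n → ℝ → ℝ) : Prop where
  regular : IsC21 u
  periodic : ∀ s, IsPeriodic (u s)
  mem_Icc : ∀ s y τ, u s y τ ∈ Icc (0 : ℝ) 1
  tendsto_atBot :
    TendstoUniformly (fun s (p : Transversal n × ℝ) => u s p.1 p.2) (fun _ => 0) atBot
  tendsto_atTop :
    TendstoUniformly (fun s (p : Transversal n × ℝ) => u s p.1 p.2) (fun _ => 1) atTop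

end ShearFront

end

/-!
The proof is by sliding. When the two drifts differ, the sign of `u_s` or of `u'_s` makes `u` a
subsolution for `β'`, or `u'` a supersolution for `β`, so that it suffices to treat a common drift
(`exists_eq_shift`). Once `u` is known to be a translate of `u'`, the two differential inequalities
give `(β' - β) u_s ≤ 0` with `u_s > 0`, hence `β' = β`.

For a common drift, let `l` be the least shift with `u ≤ u'(· + l, ·, ·)`. Such shifts exist by
`le_of_le_on_slab`: order on a slab `a ≤ s ≤ b` propagates to both ends of the cylinder. For large
`s` this holds because `f` is strictly decreasing near `1`, so the reaction term has the wrong sign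
at a negative minimum of `u' - u`. As `s → -∞` the reaction vanishes, and the strict subsolution
`ε e^{μ s}` with `μ > |β|` takes over that role. The difference `w = u'(· + l, ·, ·) - u ≥ 0`
satisfies `Δ w + β w_s - w_τ ≤ C w`, with `C` a Lipschitz constant of `f`, so by the strong maximum
principle (`eq_zero_or_pos`) it is identically zero or everywhere positive. If it were positive,
then by compactness of the period cell the order on a large slab, and hence everywhere, would
persist for slightly smaller shifts, against the choice of `l`.

The strong maximum principle has an elementary proof here (`pos_of_pos_of_lt`). Two points of the
universal cover at times `τ₀ < τ₁` are joined by a straight line; a ball moving along it carries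
the explicit subsolution `ε e^{-α (τ - τ₀)} (r² - |z|²)²`, which stays below `w`. Positivity thus
spreads to all later times, and periodicity in time brings it back to earlier ones.
-/

namespace ShearFront

/-! ### Pointwise calculus for the operator -/

/-- The regularity used in the maximum principles: joint continuity, two derivatives in `(s,y)`
for each fixed `τ`, one derivative in `τ`. Continuity of the derivatives in all the variables
together, which `IsC21` also asks for, plays no part there. -/
structure IsRegular {n : ℕ} (w : ℝ → Transversal n → ℝ → ℝ) : Prop where
  continuous : Continuous (fun p : (ℝ × Transversal n) × ℝ => w p.1.1 p.1.2 p.2)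
  contDiff_space : ∀ τ, ContDiff ℝ 2 (fun x : ℝ × Transversal n => w x.1 x.2 τ)
  differentiable_time : ∀ s y, Differentiable ℝ (w s y)

theorem IsC21.isRegular {n : ℕ} {u : ℝ → Transversal n → ℝ → ℝ} (hu : IsC21 u) :
    IsRegular u where
  continuous := by
    have h := hu.continuous_space 0 (by norm_num)
    have h2 : Continuous (fun p : (ℝ × Transversal n) × ℝ =>
        iteratedFDeriv ℝ 0 (fun x : ℝ × Transversal n => u x.1 x.2 p.2) p.1 0) := by
      fun_prop
    simpa using h2
  contDiff_space := hu.contDiff_space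
  differentiable_time := hu.differentiable_time

namespace IsRegular

variable {n : ℕ} {v w : ℝ → Transversal n → ℝ → ℝ}

theorem contDiff_s (hw : IsRegular w) (y : Transversal n) (τ : ℝ) :
    ContDiff ℝ 2 (fun r => w r y τ) :=
  (hw.contDiff_space τ).comp (contDiff_id.prodMk contDiff_const)

theorem contDiff_y (hw : IsRegular w) (s τ : ℝ) : ContDiff ℝ 2 (fun z => w s z τ) :=
  (hw.contDiff_space τ).comp (contDiff_const.prodMk contDiff_id)

theorem sub (hv : IsRegular v) (hw : IsRegular w) :
    IsRegular (fun s y τ => v s y τ - w s y τ) where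
  continuous := hv.continuous.sub hw.continuous
  contDiff_space τ := (hv.contDiff_space τ).sub (hw.contDiff_space τ)
  differentiable_time s y := (hv.differentiable_time s y).sub (hw.differentiable_time s y)

theorem shift (hw : IsRegular w) (l : ℝ) : IsRegular (fun s => w (s + l)) where
  continuous := hw.continuous.comp
    (f := fun p : (ℝ × Transversal n) × ℝ => ((p.1.1 + l, p.1.2), p.2)) (by fun_prop)
  contDiff_space τ := (hw.contDiff_space τ).comp
    (f := fun x : ℝ × Transversal n => (x.1 + l, x.2)) (by fun_prop)
  differentiable_time s y := hw.differentiable_time (s + l) y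

end IsRegular

theorem frontOp_sub {n : ℕ} {v w : ℝ → Transversal n → ℝ → ℝ} (hv : IsRegular v)
    (hw : IsRegular w) (β : Transversal n → ℝ → ℝ) (s : ℝ) (y : Transversal n) (τ : ℝ) :
    frontOp β (fun s y τ => v s y τ - w s y τ) s y τ = frontOp β v s y τ - frontOp β w s y τ := by
  have h1 : iteratedDeriv 2 (fun r => v r y τ - w r y τ) s =
      iteratedDeriv 2 (fun r => v r y τ) s - iteratedDeriv 2 (fun r => w r y τ) s :=
    iteratedDeriv_fun_sub (hv.contDiff_s y τ).contDiffAt (hw.contDiff_s y τ).contDiffAt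
  have h2 : Laplacian.laplacian (fun z => v s z τ - w s z τ) y =
      Laplacian.laplacian (fun z => v s z τ) y - Laplacian.laplacian (fun z => w s z τ) y :=
    (hv.contDiff_y s τ).contDiffAt.laplacian_sub (hw.contDiff_y s τ).contDiffAt
  have h3 : deriv (fun r => v r y τ - w r y τ) s =
      deriv (fun r => v r y τ) s - deriv (fun r => w r y τ) s :=
    deriv_fun_sub ((hv.contDiff_s y τ).differentiable two_ne_zero s)
      ((hw.contDiff_s y τ).differentiable two_ne_zero s)
  have h4 : deriv (fun t => v s y t - w s y t) τ = deriv (v s y) τ - deriv (w s y) τ :=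
    deriv_fun_sub (hv.differentiable_time s y τ) (hw.differentiable_time s y τ)
  simp only [frontOp, dS, h1, h2, h3, h4]
  ring

theorem frontOp_shift {n : ℕ} (β : Transversal n → ℝ → ℝ) (w : ℝ → Transversal n → ℝ → ℝ)
    (l s : ℝ) (y : Transversal n) (τ : ℝ) :
    frontOp β (fun s => w (s + l)) s y τ = frontOp β w (s + l) y τ := by
  have h1 : iteratedDeriv 2 (fun r => w (r + l) y τ) s =
      iteratedDeriv 2 (fun r => w r y τ) (s + l) :=
    congrFun (iteratedDeriv_comp_add_const (n := 2) (f := fun r => w r y τ) (s := l)) s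
  have h2 : deriv (fun r => w (r + l) y τ) s = deriv (fun r => w r y τ) (s + l) :=
    deriv_comp_add_const (f := fun r => w r y τ) l s
  simp only [frontOp, dS, h1, h2]

theorem frontOp_eq_add_mul_dS {n : ℕ} (β β' : Transversal n → ℝ → ℝ)
    (w : ℝ → Transversal n → ℝ → ℝ) (s : ℝ) (y : Transversal n) (τ : ℝ) :
    frontOp β' w s y τ = frontOp β w s y τ + (β' y τ - β y τ) * dS w s y τ := by
  simp only [frontOp]
  ring

theorem iteratedDeriv_two_eq {g : ℝ → ℝ} : iteratedDeriv 2 g = deriv (deriv g) := by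
  rw [iteratedDeriv_succ, iteratedDeriv_one]

theorem iteratedFDeriv_two_eq_deriv_line {E : Type*} [NormedAddCommGroup E] [NormedSpace ℝ E]
    {g : E → ℝ} (hg : ContDiff ℝ 2 g) (y e : E) :
    iteratedFDeriv ℝ 2 g y ![e, e] = iteratedDeriv 2 (fun t : ℝ => g (y + t • e)) 0 := by
  have hline : ∀ t : ℝ, HasDerivAt (fun t : ℝ => y + t • e) e t := fun t => by
    simpa using ((hasDerivAt_id t).smul_const e).const_add y
  have h1 : deriv (fun t : ℝ => g (y + t • e)) = fun t => fderiv ℝ g (y + t • e) e := by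
    funext t
    exact ((hg.differentiable two_ne_zero _).hasFDerivAt.comp_hasDerivAt t (hline t)).deriv
  have h2 : Differentiable ℝ (fderiv ℝ g) :=
    (hg.fderiv_right (m := 1) (by norm_num)).differentiable one_ne_zero
  have h3 : HasDerivAt (fun t : ℝ => fderiv ℝ g (y + t • e))
      (fderiv ℝ (fderiv ℝ g) (y + (0 : ℝ) • e) e) 0 :=
    (h2 _).hasFDerivAt.comp_hasDerivAt 0 (hline 0)
  rw [iteratedFDeriv_two_apply, iteratedDeriv_two_eq, h1]
  simpa using ((h3.clm_apply (hasDerivAt_const 0 e)).deriv).symm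

theorem laplacian_eq_sum_line {n : ℕ} {g : Transversal n → ℝ} (hg : ContDiff ℝ 2 g)
    (y : Transversal n) :
    Laplacian.laplacian g y =
      ∑ i, iteratedDeriv 2 (fun t : ℝ => g (y + t • EuclideanSpace.single i 1)) 0 := by
  rw [InnerProductSpace.laplacian_eq_iteratedFDeriv_orthonormalBasis g
    (EuclideanSpace.basisFun (Fin (n - 1)) ℝ)]
  simp [iteratedFDeriv_two_eq_deriv_line hg]

theorem iteratedDeriv_two_nonneg_of_isLocalMin {g : ℝ → ℝ} {x : ℝ} (h : IsLocalMin g x)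
    (hc : ContinuousAt g x) : 0 ≤ iteratedDeriv 2 g x := by
  rw [iteratedDeriv_two_eq]
  by_contra! hneg
  -- a strict sign would make `x` a local maximum too, so that `g` is constant near `x`
  have hmax := isLocalMax_of_deriv_deriv_neg hneg h.deriv_eq_zero hc
  have hconst : g =ᶠ[𝓝 x] fun _ => g x := by
    filter_upwards [h, hmax] with z h1 h2 using le_antisymm h2 h1
  have h0 : deriv (deriv g) x = 0 := by
    rw [hconst.deriv.deriv_eq]
    simp
  exact hneg.ne h0

theorem deriv_nonpos_of_le_left {g : ℝ → ℝ} {x : ℝ} (hg : DifferentiableAt ℝ g x)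
    (h : ∀ᶠ t in 𝓝[<] x, g x ≤ g t) : deriv g x ≤ 0 := by
  have h1 : Tendsto (slope g x) (𝓝[<] x) (𝓝 (deriv g x)) :=
    (hasDerivAt_iff_tendsto_slope.1 hg.hasDerivAt).mono_left
      (nhdsWithin_mono _ fun t (ht : t < x) => ht.ne)
  refine le_of_tendsto h1 ?_
  filter_upwards [h, self_mem_nhdsWithin] with t ht htx
  rw [slope_def_field]
  exact div_nonpos_of_nonneg_of_nonpos (by linarith) (by linarith [mem_Iio.1 htx])

/-- The operator is nonnegative at a minimum which is local in `(s,y)` and one-sided in time: only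
earlier times are compared. -/
theorem frontOp_nonneg_of_min {n : ℕ} {w : ℝ → Transversal n → ℝ → ℝ} (hw : IsRegular w)
    (β : Transversal n → ℝ → ℝ) {s : ℝ} {y : Transversal n} {τ : ℝ}
    (hx : IsLocalMin (fun x : ℝ × Transversal n => w x.1 x.2 τ) (s, y))
    (ht : ∀ᶠ t in 𝓝[<] τ, w s y τ ≤ w s y t) :
    0 ≤ frontOp β w s y τ := by
  have hs : IsLocalMin (fun r => w r y τ) s := by
    have hc : ContinuousAt (fun r : ℝ => (r, y)) s := by fun_prop
    exact hc.eventually hx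
  have hss := iteratedDeriv_two_nonneg_of_isLocalMin hs (hw.contDiff_s y τ).continuous.continuousAt
  have hd : dS w s y τ = 0 := hs.deriv_eq_zero
  have hlap : 0 ≤ Laplacian.laplacian (fun z => w s z τ) y := by
    rw [laplacian_eq_sum_line (hw.contDiff_y s τ)]
    refine Finset.sum_nonneg fun i _ => iteratedDeriv_two_nonneg_of_isLocalMin ?_ ?_
    · have hc : ContinuousAt
          (fun t : ℝ => (s, y + t • (EuclideanSpace.single i 1 : Transversal n))) 0 := by fun_prop
      have hx' : ∀ᶠ x : ℝ × Transversal n in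
          𝓝 (s, y + (0 : ℝ) • (EuclideanSpace.single i 1 : Transversal n)),
          w s y τ ≤ w x.1 x.2 τ := by
        rw [zero_smul, add_zero]
        exact hx
      have := hc.eventually hx'
      simpa [IsLocalMin, IsMinFilter] using this
    · exact ((hw.contDiff_y s τ).continuous.comp
        (f := fun t : ℝ => y + t • (EuclideanSpace.single i 1 : Transversal n))
        (by fun_prop)).continuousAt
  have hdt := deriv_nonpos_of_le_left (hw.differentiable_time s y τ) ht
  simp only [frontOp, hd]
  linarith

/-! ### Periodicity and existence of minima -/

/-- Every point of the universal cover has a translate in the closed unit cell at which every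
periodic function takes the same value. -/
theorem exists_mem_cell {n : ℕ} (y : Transversal n) (τ : ℝ) :
    ∃ z ∈ WithLp.toLp 2 '' (Icc (0 : Fin (n - 1) → ℝ) 1), ∃ t ∈ Icc (0 : ℝ) 1,
      ∀ g : Transversal n → ℝ → ℝ, IsPeriodic g → g y τ = g z t := by
  refine ⟨WithLp.toLp 2 fun i => Int.fract (y i),
    ⟨_, ⟨fun i => Int.fract_nonneg _, fun i => (Int.fract_lt_one _).le⟩, rfl⟩, Int.fract τ,
    ⟨Int.fract_nonneg _, (Int.fract_lt_one _).le⟩, fun g hg => ?_⟩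
  let P : AddSubgroup (Transversal n) :=
    { carrier := {c | ∀ y τ, g (y + c) τ = g y τ}
      zero_mem' := by simp
      add_mem' := fun {a b} ha hb y τ => by rw [← add_assoc, hb, ha]
      neg_mem' := fun {a} ha y τ => by simpa using (ha (y + -a) τ).symm }
  have hP : ∑ i, ⌊y i⌋ • (EuclideanSpace.single i 1 : Transversal n) ∈ P :=
    sum_mem fun i _ => zsmul_mem (show EuclideanSpace.single i 1 ∈ P from
      fun y τ => hg.space y τ i) _
  have hy : y = (WithLp.toLp 2 fun i => Int.fract (y i)) +
      ∑ i, ⌊y i⌋ • (EuclideanSpace.single i 1 : Transversal n) := by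
    ext j
    simp [Pi.single_apply, Int.fract_add_floor]
  have hτ : ∀ z, Function.Periodic (g z) 1 := fun z t => hg.time z t
  have h1 := hP (WithLp.toLp 2 fun i => Int.fract (y i)) τ
  rw [← hy] at h1
  rw [h1]
  have := (hτ (WithLp.toLp 2 fun i => Int.fract (y i))).sub_int_mul_eq ⌊τ⌋ (x := τ)
  rw [← this, Int.fract]
  simp

theorem isCompact_cell (n : ℕ) :
    IsCompact (WithLp.toLp 2 '' (Icc (0 : Fin (n - 1) → ℝ) 1) : Set (Transversal n)) :=
  isCompact_Icc.image (PiLp.continuous_toLp 2 _)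

/-- A periodic function with nonnegative lower limits as `s → ±∞` in a closed set `A` of values
of `s`, and negative somewhere over `A`, attains its minimum over `A`. -/
theorem exists_min_of_neg {n : ℕ} {h : ℝ → Transversal n → ℝ → ℝ}
    (hc : Continuous (fun p : (ℝ × Transversal n) × ℝ => h p.1.1 p.1.2 p.2))
    (hper : ∀ s, IsPeriodic (h s)) {A : Set ℝ} (hA : IsClosed A)
    (hlim : ∀ ε > 0, ∃ M, ∀ s ∈ A, M ≤ |s| → ∀ y τ, -ε < h s y τ)
    {s₁ : ℝ} (hs₁ : s₁ ∈ A) {y₁ : Transversal n} {τ₁ : ℝ} (hneg : h s₁ y₁ τ₁ < 0) :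
    ∃ s₀ ∈ A, ∃ y₀ τ₀, ∀ s ∈ A, ∀ y τ, h s₀ y₀ τ₀ ≤ h s y τ := by
  obtain ⟨M, hM⟩ := hlim (-h s₁ y₁ τ₁) (by linarith)
  let S : Set ((ℝ × Transversal n) × ℝ) :=
    ((A ∩ Icc (-M) M) ×ˢ (WithLp.toLp 2 '' (Icc (0 : Fin (n - 1) → ℝ) 1))) ×ˢ Icc (0 : ℝ) 1
  have hS : IsCompact S :=
    ((isCompact_Icc.inter_left hA).prod (isCompact_cell n)).prod isCompact_Icc
  have hM₁ : ∀ s ∈ A, (∃ y τ, h s y τ ≤ h s₁ y₁ τ₁) → s ∈ Icc (-M) M := by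
    rintro s hs ⟨y, τ, hle⟩
    rw [mem_Icc, ← abs_le]
    by_contra! hlt
    linarith [hM s hs hlt.le y τ]
  obtain ⟨z₁, hz₁, t₁, ht₁, he₁⟩ := exists_mem_cell y₁ τ₁
  have hne : S.Nonempty := ⟨((s₁, z₁), t₁), ⟨⟨hs₁, hM₁ s₁ hs₁ ⟨y₁, τ₁, le_rfl⟩⟩, hz₁⟩, ht₁⟩
  obtain ⟨⟨⟨s₀, y₀⟩, τ₀⟩, hp₀, hmin⟩ := hS.exists_isMinOn hne hc.continuousOn
  have h01 : h s₀ y₀ τ₀ ≤ h s₁ y₁ τ₁ := by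
    rw [he₁ (h s₁) (hper s₁)]
    exact hmin (show ((s₁, z₁), t₁) ∈ S from
      ⟨⟨⟨hs₁, hM₁ s₁ hs₁ ⟨y₁, τ₁, le_rfl⟩⟩, hz₁⟩, ht₁⟩)
  refine ⟨s₀, hp₀.1.1.1, y₀, τ₀, fun s hs y τ => ?_⟩
  by_contra! hlt
  obtain ⟨z, hz, t, ht, he⟩ := exists_mem_cell y τ
  have hsM := hM₁ s hs ⟨y, τ, by linarith⟩
  have := hmin (show ((s, z), t) ∈ S from ⟨⟨⟨hs, hsM⟩, hz⟩, ht⟩)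
  have h2 : h s₀ y₀ τ₀ ≤ h s z t := this
  rw [← he (h s) (hper s)] at h2
  linarith

theorem exists_abs_le_of_periodic {n : ℕ} {g : Transversal n → ℝ → ℝ}
    (hc : Continuous (fun p : Transversal n × ℝ => g p.1 p.2)) (hg : IsPeriodic g) :
    ∃ B, ∀ y τ, |g y τ| ≤ B := by
  obtain ⟨B, hB⟩ := ((isCompact_cell n).prod
    (isCompact_Icc (a := (0 : ℝ)) (b := 1))).exists_bound_of_continuousOn hc.continuousOn
  refine ⟨B, fun y τ => ?_⟩
  obtain ⟨z, hz, t, ht, he⟩ := exists_mem_cell y τ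
  rw [he g hg]
  exact hB (z, t) ⟨hz, ht⟩

/-! ### Comparison in the two ends of the cylinder -/

theorem IsCombustion.exists_strictAntiOn {f : ℝ → ℝ} (hf : IsCombustion f) {θ : ℝ} (hθ : θ < 1) :
    ∃ a ∈ Ico θ 1, StrictAntiOn f (Icc a 1) := by
  have hc : ContinuousOn (derivWithin f (Icc 0 1)) (Icc 0 1) :=
    hf.contDiffOn.continuousOn_derivWithin (uniqueDiffOn_Icc one_pos) le_rfl
  have hev : ∀ᶠ x in 𝓝[Icc 0 1] (1 : ℝ), derivWithin f (Icc 0 1) x < 0 :=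
    (hc 1 (right_mem_Icc.2 zero_le_one)).eventually_lt_const hf.deriv_one
  obtain ⟨δ, hδ, hball⟩ := Metric.mem_nhdsWithin_iff.1 hev
  have h1 : max (max θ 0) (1 - δ / 2) < 1 :=
    max_lt (max_lt hθ one_pos) (by linarith)
  refine ⟨max (max θ 0) (1 - δ / 2), ⟨(le_max_left _ _).trans (le_max_left _ _), h1⟩, ?_⟩
  have h0 : 0 ≤ max (max θ 0) (1 - δ / 2) := (le_max_right _ _).trans (le_max_left _ _)
  have hsub : Icc (max (max θ 0) (1 - δ / 2)) 1 ⊆ Icc 0 1 := Icc_subset_Icc_left h0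
  refine strictAntiOn_of_deriv_neg (convex_Icc _ _) (hf.contDiffOn.continuousOn.mono hsub) ?_
  intro x hx
  rw [interior_Icc] at hx
  have hx01 : x ∈ Ioo (0 : ℝ) 1 := ⟨h0.trans_lt hx.1, hx.2⟩
  rw [← derivWithin_of_mem_nhds (Icc_mem_nhds hx01.1 hx01.2)]
  refine hball ⟨?_, Ioo_subset_Icc_self hx01⟩
  have := (le_max_right _ _).trans_lt hx.1
  rw [Metric.mem_ball, Real.dist_eq, abs_lt]
  constructor <;> linarith [hx.2]

theorem isRegular_exp {n : ℕ} (ε μ : ℝ) :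
    IsRegular (fun (s : ℝ) (_ : Transversal n) (_ : ℝ) => ε * Real.exp (μ * s)) where
  continuous := by fun_prop
  contDiff_space τ := by fun_prop
  differentiable_time s y := by fun_prop

theorem frontOp_exp {n : ℕ} (β : Transversal n → ℝ → ℝ) (ε μ s : ℝ) (y : Transversal n) (τ : ℝ) :
    frontOp β (fun (s : ℝ) (_ : Transversal n) (_ : ℝ) => ε * Real.exp (μ * s)) s y τ =
      ε * (μ ^ 2 + β y τ * μ) * Real.exp (μ * s) := by
  have hd : ∀ c : ℝ, deriv (fun r => c * Real.exp (μ * r)) = fun r => c * μ * Real.exp (μ * r) := by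
    intro c
    funext r
    have h := (((hasDerivAt_id r).const_mul μ).exp.const_mul c).deriv
    simp only [id, mul_one] at h
    rw [h]
    ring
  have hl : Laplacian.laplacian (fun _ : Transversal n => ε * Real.exp (μ * s)) y = 0 := by
    rw [InnerProductSpace.laplacian_const]
    rfl
  simp only [frontOp, dS, iteratedDeriv_two_eq, hd, hl, deriv_const]
  ring

/-- The lower limits at infinity of a difference of front profiles are nonnegative. -/
theorem IsFrontProfile.exists_neg_lt_sub {n : ℕ} {u v : ℝ → Transversal n → ℝ → ℝ}
    (hu : IsFrontProfile u) (hv : IsFrontProfile v) {ε : ℝ} (hε : 0 < ε) :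
    ∃ M, ∀ s, M ≤ |s| → ∀ y τ, -ε < v s y τ - u s y τ := by
  obtain ⟨M₁, h₁⟩ := eventually_atBot.1 (Metric.tendstoUniformly_iff.1 hu.tendsto_atBot ε hε)
  obtain ⟨M₂, h₂⟩ := eventually_atTop.1 (Metric.tendstoUniformly_iff.1 hv.tendsto_atTop ε hε)
  refine ⟨max (-M₁) M₂, fun s hs y τ => ?_⟩
  have hu1 := hu.mem_Icc s y τ
  have hv1 := hv.mem_Icc s y τ
  rcases le_abs'.1 hs with h | h
  · have := h₁ s (by linarith [le_max_left (-M₁) M₂]) (y, τ)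
    rw [Real.dist_eq, abs_lt] at this
    linarith [hv1.1]
  · have := h₂ s (by linarith [le_max_right (-M₁) M₂]) (y, τ)
    rw [Real.dist_eq, abs_lt] at this
    linarith [hu1.2]

theorem IsFrontProfile.shift {n : ℕ} {u : ℝ → Transversal n → ℝ → ℝ}
    (hu : IsFrontProfile u) (l : ℝ) : IsFrontProfile (fun s => u (s + l)) where
  regular :=
    { contDiff_space := fun τ => (hu.regular.contDiff_space τ).comp
        (f := fun x : ℝ × Transversal n => (x.1 + l, x.2)) (by fun_prop)
      continuous_space := fun k hk => by
        have h : ∀ p : (ℝ × Transversal n) × ℝ,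
            iteratedFDeriv ℝ k (fun x : ℝ × Transversal n => u (x.1 + l) x.2 p.2) p.1 =
              iteratedFDeriv ℝ k (fun x : ℝ × Transversal n => u x.1 x.2 p.2) (p.1 + (l, 0)) := by
          intro p
          rw [← iteratedFDeriv_comp_add_right]
          simp
        simp only [h]
        exact (hu.regular.continuous_space k hk).comp
          (f := fun p : (ℝ × Transversal n) × ℝ => (p.1 + (l, 0), p.2)) (by fun_prop)
      differentiable_time := fun s y => hu.regular.differentiable_time (s + l) y
      continuous_time := hu.regular.continuous_time.comp
        (f := fun p : (ℝ × Transversal n) × ℝ => ((p.1.1 + l, p.1.2), p.2)) (by fun_prop) }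
  periodic s := hu.periodic (s + l)
  mem_Icc s := hu.mem_Icc (s + l)
  tendsto_atBot t ht :=
    (tendsto_atBot_add_const_right atBot l tendsto_id).eventually (hu.tendsto_atBot t ht)
  tendsto_atTop t ht :=
    (tendsto_atTop_add_const_right atTop l tendsto_id).eventually (hu.tendsto_atTop t ht)

/-- Order of a subsolution `u` and a supersolution `v` on the slab `a ≤ s ≤ b` propagates to the
whole cylinder when `u` is below the ignition temperature to the left of the slab, and `v` is so
close to `1` to the right of it that `f` decreases there. -/
theorem le_of_le_on_slab {n : ℕ} {f : ℝ → ℝ} {θ κ : ℝ} (hfθ : ∀ x ∈ Icc 0 θ, f x = 0)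
    (hfκ : StrictAntiOn f (Icc κ 1)) {β : Transversal n → ℝ → ℝ}
    (hβc : Continuous (fun p : Transversal n × ℝ => β p.1 p.2)) (hβ : IsPeriodic β)
    {u v : ℝ → Transversal n → ℝ → ℝ} (hu : IsFrontProfile u) (hv : IsFrontProfile v)
    (hsub : ∀ s y τ, 0 ≤ frontOp β u s y τ + f (u s y τ))
    (hsuper : ∀ s y τ, frontOp β v s y τ + f (v s y τ) ≤ 0)
    {a b : ℝ} (ha : ∀ s ≤ a, ∀ y τ, u s y τ ≤ θ) (hb : ∀ s ≥ b, ∀ y τ, κ ≤ v s y τ)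
    (hab : a ≤ b) (hle : ∀ s ∈ Icc a b, ∀ y τ, u s y τ ≤ v s y τ) (s : ℝ) (y : Transversal n)
    (τ : ℝ) : u s y τ ≤ v s y τ := by
  have hur := hu.regular.isRegular
  have hvr := hv.regular.isRegular
  by_contra! hneg
  rcases lt_or_ge s a with hsa | hsa
  · -- left end: `ε * exp (μ * s)` is a strict subsolution since `μ > |β|`
    obtain ⟨B, hB⟩ := exists_abs_le_of_periodic hβc hβ
    have hB0 : 0 ≤ B := (abs_nonneg _).trans (hB y τ)
    set μ := B + 1 with hμ
    set ε := (u s y τ - v s y τ) / (2 * Real.exp (μ * a)) with hεdef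
    have hea := Real.exp_pos (μ * a)
    have hε : 0 < ε := div_pos (by linarith) (by positivity)
    have hεa : ε * Real.exp (μ * a) = (u s y τ - v s y τ) / 2 := by
      rw [hεdef]
      field_simp
    have hexp : ∀ r ≤ a, ε * Real.exp (μ * r) ≤ ε * Real.exp (μ * a) := fun r hr => by gcongr
    have hreg := (hvr.sub hur).sub (isRegular_exp (n := n) ε μ)
    have hlim : ∀ η > 0, ∃ M, ∀ r ∈ Iic a, M ≤ |r| → ∀ z t,
        -η < v r z t - u r z t - ε * Real.exp (μ * r) := by
      intro η hη
      obtain ⟨M, hM⟩ := hu.exists_neg_lt_sub hv (half_pos hη)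
      have htend : Tendsto (fun r => ε * Real.exp (μ * r)) atBot (𝓝 0) := by
        have := (Real.tendsto_exp_atBot.comp
          (tendsto_id.const_mul_atBot (show 0 < μ by linarith))).const_mul ε
        simpa using this
      obtain ⟨N, hN⟩ := eventually_atBot.1 (htend.eventually_lt_const (half_pos hη))
      refine ⟨max M (max (-N) (|a| + 1)), fun r hr hrM z t => ?_⟩
      have h1 := hM r ((le_max_left _ _).trans hrM) z t
      have h2 : -N ≤ |r| := ((le_max_left _ _).trans (le_max_right _ _)).trans hrM
      have h3 : |a| + 1 ≤ |r| := ((le_max_right _ _).trans (le_max_right _ _)).trans hrM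
      have hr0 : r ≤ 0 := by
        by_contra! h
        rw [abs_of_pos h] at h3
        linarith [le_abs_self a, mem_Iic.1 hr]
      rw [abs_of_nonpos hr0] at h2
      linarith [hN r (by linarith)]
    have hper : ∀ r, IsPeriodic (fun z t => v r z t - u r z t - ε * Real.exp (μ * r)) := fun r =>
      { space := fun z t i => by rw [(hv.periodic r).space, (hu.periodic r).space]
        time := fun z t => by rw [(hv.periodic r).time, (hu.periodic r).time] }
    obtain ⟨s₀, hs₀, y₀, τ₀, hmin⟩ := exists_min_of_neg hreg.continuous hper isClosed_Iic hlim
      (mem_Iic.2 hsa.le) (y₁ := y) (τ₁ := τ)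
      (by linarith [mul_pos hε (Real.exp_pos (μ * s))])
    have hval := hmin s hsa.le y τ
    have hs₀' : s₀ < a := by
      refine lt_of_le_of_ne hs₀ fun h => ?_
      have := hle s₀ ⟨h.ge, h.le.trans hab⟩ y₀ τ₀
      have h2 := mul_pos hε (Real.exp_pos (μ * s))
      rw [h] at hval this
      linarith
    have hlt : v s₀ y₀ τ₀ < u s₀ y₀ τ₀ := by
      have h2 := mul_pos hε (Real.exp_pos (μ * s))
      linarith [hexp s₀ hs₀]
    have hop := frontOp_nonneg_of_min hreg β (s := s₀) (y := y₀) (τ := τ₀)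
      (by
        have : ∀ᶠ x : ℝ × Transversal n in 𝓝 (s₀, y₀), x.1 < a :=
          (continuous_fst.tendsto _).eventually_lt_const hs₀'
        filter_upwards [this] with x hx using hmin x.1 hx.le x.2 τ₀)
      (Eventually.of_forall fun t => hmin s₀ hs₀ y₀ t)
    rw [frontOp_sub (hvr.sub hur) (isRegular_exp ε μ), frontOp_sub hvr hur, frontOp_exp] at hop
    have hfu := hfθ _ ⟨(hu.mem_Icc s₀ y₀ τ₀).1, ha s₀ hs₀ y₀ τ₀⟩
    have hfv := hfθ _ ⟨(hv.mem_Icc s₀ y₀ τ₀).1, hlt.le.trans (ha s₀ hs₀ y₀ τ₀)⟩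
    have h1 := hsub s₀ y₀ τ₀
    have h2 := hsuper s₀ y₀ τ₀
    have h3 : 0 < μ ^ 2 + β y₀ τ₀ * μ := by
      have := (abs_le.1 (hB y₀ τ₀)).1
      have h : μ ^ 2 + β y₀ τ₀ * μ = μ * (μ + β y₀ τ₀) := by ring
      rw [h]
      exact mul_pos (by linarith) (by linarith)
    have h4 := mul_pos (mul_pos hε h3) (Real.exp_pos (μ * s₀))
    linarith
  rcases le_or_gt s b with hsb | hsb
  · exact hneg.not_ge (hle s ⟨hsa, hsb⟩ y τ)
  · -- right end: at a negative minimum of `v - u` the reaction term has the wrong sign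
    have hper : ∀ r, IsPeriodic (fun z t => v r z t - u r z t) := fun r =>
      { space := fun z t i => by rw [(hv.periodic r).space, (hu.periodic r).space]
        time := fun z t => by rw [(hv.periodic r).time, (hu.periodic r).time] }
    have hreg := hvr.sub hur
    obtain ⟨s₀, hs₀, y₀, τ₀, hmin⟩ := exists_min_of_neg hreg.continuous hper
      (isClosed_Ici (a := b))
      (fun ε hε => (hu.exists_neg_lt_sub hv hε).imp fun M hM r _ => hM r)
      (mem_Ici.2 hsb.le) (y₁ := y) (τ₁ := τ) (by linarith)
    have hval := hmin s hsb.le y τ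
    have hs₀' : b < s₀ := by
      refine lt_of_le_of_ne hs₀ fun h => ?_
      have := hle s₀ ⟨hab.trans h.le, h.ge⟩ y₀ τ₀
      linarith
    have hlt : v s₀ y₀ τ₀ < u s₀ y₀ τ₀ := by linarith
    have hop := frontOp_nonneg_of_min hreg β (s := s₀) (y := y₀) (τ := τ₀)
      (by
        have : ∀ᶠ x : ℝ × Transversal n in 𝓝 (s₀, y₀), b < x.1 :=
          (continuous_fst.tendsto _).eventually_const_lt hs₀'
        filter_upwards [this] with x hx using hmin x.1 hx.le x.2 τ₀)
      (Eventually.of_forall fun t => hmin s₀ hs₀ y₀ t)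
    rw [frontOp_sub hvr hur] at hop
    have hv₀ := hb s₀ hs₀ y₀ τ₀
    have hff := hfκ ⟨hv₀, (hv.mem_Icc s₀ y₀ τ₀).2⟩
      ⟨hv₀.trans hlt.le, (hu.mem_Icc s₀ y₀ τ₀).2⟩ hlt
    linarith [hsub s₀ y₀ τ₀, hsuper s₀ y₀ τ₀]

/-! ### The strong maximum principle -/

/-- The moving-ball barrier `ε e^{-α(τ - τ₀)} (r² - |(s,y) - x(τ)|²)²`, whose centre
`x(τ) = (σ₀ + (τ - τ₀) σ₁, η₀ + (τ - τ₀) η₁)` moves along a straight line. It is not cut off outside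
the ball: it is only used inside, where it vanishes on the lateral boundary. -/
noncomputable def ballBarrier {n : ℕ} (ε α r τ₀ σ₀ σ₁ : ℝ) (η₀ η₁ : Transversal n) (s : ℝ)
    (y : Transversal n) (τ : ℝ) : ℝ :=
  ε * Real.exp (-α * (τ - τ₀)) *
    (r ^ 2 - (s - (σ₀ + (τ - τ₀) * σ₁)) ^ 2 - ‖y - (η₀ + (τ - τ₀) • η₁)‖ ^ 2) ^ 2

theorem isRegular_ballBarrier {n : ℕ} (ε α r τ₀ σ₀ σ₁ : ℝ) (η₀ η₁ : Transversal n) :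
    IsRegular (ballBarrier ε α r τ₀ σ₀ σ₁ η₀ η₁) where
  continuous := by
    unfold ballBarrier
    fun_prop
  contDiff_space τ := by
    unfold ballBarrier
    have : ContDiff ℝ 2 fun x : ℝ × Transversal n => ‖x.2 - (η₀ + (τ - τ₀) • η₁)‖ ^ 2 :=
      ContDiff.norm_sq ℝ (by fun_prop)
    fun_prop
  differentiable_time s y := by
    unfold ballBarrier
    have : Differentiable ℝ fun τ : ℝ => ‖y - (η₀ + (τ - τ₀) • η₁)‖ ^ 2 :=
      Differentiable.norm_sq ℝ (by fun_prop)
    fun_prop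

theorem iteratedDeriv_two_sq_quadratic (c q b x : ℝ) :
    iteratedDeriv 2 (fun t => c * (q - 2 * t * b - t ^ 2) ^ 2) x =
      c * (8 * (b + x) ^ 2 - 4 * (q - 2 * x * b - x ^ 2)) := by
  have h1 : deriv (fun t => c * (q - 2 * t * b - t ^ 2) ^ 2) =
      fun t => c * (-4 * ((q - 2 * t * b - t ^ 2) * (b + t))) := by
    funext t
    have h : HasDerivAt (fun t => q - 2 * t * b - t ^ 2) (-2 * b - 2 * t) t := by
      convert! ((((hasDerivAt_id t).const_mul 2).mul_const b).const_sub q).sub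
        ((hasDerivAt_id t).pow 2) using 1
      simp
    refine ((h.pow 2).const_mul c).deriv.trans ?_
    simp [-mul_eq_mul_left_iff]
    ring
  rw [iteratedDeriv_two_eq, h1]
  have h : HasDerivAt (fun t => q - 2 * t * b - t ^ 2) (-2 * b - 2 * x) x := by
    convert! ((((hasDerivAt_id x).const_mul 2).mul_const b).const_sub q).sub
      ((hasDerivAt_id x).pow 2) using 1
    simp
  refine (((h.mul ((hasDerivAt_id x).const_add b)).const_mul (-4)).const_mul c).deriv.trans ?_
  simp [-mul_eq_mul_left_iff]
  ring

theorem frontOp_ballBarrier {n : ℕ} (β : Transversal n → ℝ → ℝ) (ε α r τ₀ σ₀ σ₁ : ℝ)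
    (η₀ η₁ : Transversal n) (s : ℝ) (y : Transversal n) (τ : ℝ) {z : ℝ} {ζ : Transversal n}
    {q : ℝ} (hz : s - (σ₀ + (τ - τ₀) * σ₁) = z) (hζ : y - (η₀ + (τ - τ₀) • η₁) = ζ)
    (hq : r ^ 2 - z ^ 2 - ‖ζ‖ ^ 2 = q) :
    frontOp β (ballBarrier ε α r τ₀ σ₀ σ₁ η₀ η₁) s y τ =
      ε * Real.exp (-α * (τ - τ₀)) * (8 * (z ^ 2 + ‖ζ‖ ^ 2) - 4 * (1 + (n - 1 : ℕ)) * q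
        - 4 * β y τ * z * q + α * q ^ 2 - 4 * q * (z * σ₁ + inner ℝ ζ η₁)) := by
  set E := ε * Real.exp (-α * (τ - τ₀)) with hE
  have hss : iteratedDeriv 2 (fun ρ => ballBarrier ε α r τ₀ σ₀ σ₁ η₀ η₁ ρ y τ) s =
      E * (8 * z ^ 2 - 4 * q) := by
    have h1 : (fun ρ => ballBarrier ε α r τ₀ σ₀ σ₁ η₀ η₁ ρ y τ) = fun ρ =>
        (fun t => E * ((r ^ 2 - ‖ζ‖ ^ 2) - 2 * t * 0 - t ^ 2) ^ 2)
          (ρ + -(σ₀ + (τ - τ₀) * σ₁)) := by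
      funext ρ
      simp only [ballBarrier, hζ, hE]
      ring
    rw [h1]
    refine (congrFun (iteratedDeriv_comp_add_const 2
      (fun t => E * ((r ^ 2 - ‖ζ‖ ^ 2) - 2 * t * 0 - t ^ 2) ^ 2) _) s).trans ?_
    simp only [iteratedDeriv_two_sq_quadratic]
    rw [← sub_eq_add_neg, hz, ← hq]
    ring
  have hds : dS (ballBarrier ε α r τ₀ σ₀ σ₁ η₀ η₁) s y τ = E * (-4 * z * q) := by
    have h := (((((hasDerivAt_id s).sub_const (σ₀ + (τ - τ₀) * σ₁)).pow 2).const_sub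
      (r ^ 2)).sub_const (‖ζ‖ ^ 2)).pow 2 |>.const_mul E
    have h' : (fun ρ => ballBarrier ε α r τ₀ σ₀ σ₁ η₀ η₁ ρ y τ) = fun ρ =>
        E * (r ^ 2 - (ρ - (σ₀ + (τ - τ₀) * σ₁)) ^ 2 - ‖ζ‖ ^ 2) ^ 2 := by
      funext ρ
      simp only [ballBarrier, hζ, hE]
    rw [dS, h']
    refine h.deriv.trans ?_
    simp [hz, hq, -mul_eq_mul_left_iff]
    ring
  have hlap : Laplacian.laplacian (fun x => ballBarrier ε α r τ₀ σ₀ σ₁ η₀ η₁ s x τ) y =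
      E * (8 * ‖ζ‖ ^ 2 - 4 * (n - 1 : ℕ) * q) := by
    rw [laplacian_eq_sum_line ((isRegular_ballBarrier ..).contDiff_y s τ)]
    have h1 : ∀ i, (fun t : ℝ => ballBarrier ε α r τ₀ σ₀ σ₁ η₀ η₁ s
        (y + t • (EuclideanSpace.single i 1 : Transversal n)) τ) =
        fun t => E * (q - 2 * t * ζ i - t ^ 2) ^ 2 := by
      intro i
      funext t
      have h2 : y + t • (EuclideanSpace.single i 1 : Transversal n) - (η₀ + (τ - τ₀) • η₁) =
          ζ + t • (EuclideanSpace.single i 1 : Transversal n) := by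
        rw [← hζ]
        abel
      have h3 : ‖ζ + t • (EuclideanSpace.single i 1 : Transversal n)‖ ^ 2 =
          ‖ζ‖ ^ 2 + 2 * t * ζ i + t ^ 2 := by
        rw [norm_add_sq_real, inner_smul_right, EuclideanSpace.inner_single_right, norm_smul]
        simp
        ring
      simp only [ballBarrier, h2, h3, hz, ← hq, hE]
      ring
    simp only [h1, iteratedDeriv_two_sq_quadratic]
    rw [← Finset.mul_sum, Finset.sum_sub_distrib, EuclideanSpace.real_norm_sq_eq, Finset.mul_sum]
    simp [-mul_eq_mul_left_iff]
    ring
  have hdt : deriv (ballBarrier ε α r τ₀ σ₀ σ₁ η₀ η₁ s y) τ =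
      E * (-α * q ^ 2 + 4 * q * (z * σ₁ + inner ℝ ζ η₁)) := by
    have he : HasDerivAt (fun t => ε * Real.exp (-α * (t - τ₀))) (-α * E) τ := by
      convert! ((((hasDerivAt_id τ).sub_const τ₀).const_mul (-α)).exp).const_mul ε using 1
      simp [hE]
      ring
    have h1 : HasDerivAt (fun t => (s - (σ₀ + (t - τ₀) * σ₁)) ^ 2) (-2 * z * σ₁) τ := by
      convert! (((((hasDerivAt_id τ).sub_const τ₀).mul_const σ₁).const_add σ₀).const_sub s).pow 2
        using 1
      simp [hz]
    have h2 : HasDerivAt (fun t : ℝ => ‖y - (η₀ + (t - τ₀) • η₁)‖ ^ 2) (-2 * inner ℝ ζ η₁) τ := by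
      convert! (((((hasDerivAt_id τ).sub_const τ₀).smul_const η₁).const_add η₀).const_sub
        y).norm_sq using 1
      simp [hζ]
    have h := (he.mul (((h1.const_sub (r ^ 2)).sub h2).pow 2)).deriv
    refine Eq.trans h ?_
    simp only [Pi.pow_apply, Pi.sub_apply, hz, hζ, hq, ← hE]
    norm_num
    ring
  rw [frontOp, hss, hlap, hds, hdt]
  ring

/-- For the decay rate `α = C + A² / r²` the barrier beats the reaction term `C q²`, whatever the
value of `q = r² - |z|²` inside the ball. -/
theorem reaction_lt_barrier_coeff {r q b z B C N d p A : ℝ} (hr : 0 < r) (hq : 0 < q)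
    (hbz : b * z ≤ B * r) (hd : d ≤ r * p) (hA : A = 8 + 4 * N + 4 * B * r + 4 * r * p) :
    C * q ^ 2 < 8 * (r ^ 2 - q) - 4 * N * q - 4 * b * z * q + (C + A ^ 2 / r ^ 2) * q ^ 2
      - 4 * q * d := by
  have h2 := mul_le_mul_of_nonneg_left hbz hq.le
  have h3 := mul_le_mul_of_nonneg_left hd hq.le
  have h4 : 0 < 8 * r ^ 2 - A * q + A ^ 2 / r ^ 2 * q ^ 2 := by
    have : 8 * r ^ 2 - A * q + A ^ 2 / r ^ 2 * q ^ 2 =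
        (A * q / r - r / 2) ^ 2 + 31 / 4 * r ^ 2 := by
      field_simp
      ring
    rw [this]
    positivity
  have h6 : A * q = 8 * q + 4 * N * q + 4 * (q * (B * r)) + 4 * (q * (r * p)) := by
    rw [hA]
    ring
  have h7 : 8 * (r ^ 2 - q) - 4 * N * q - 4 * b * z * q + (C + A ^ 2 / r ^ 2) * q ^ 2
      - 4 * q * d - C * q ^ 2 = (8 * r ^ 2 - A * q + A ^ 2 / r ^ 2 * q ^ 2) +
        4 * (q * (B * r) - q * (b * z)) + 4 * (q * (r * p) - q * d) := by
    rw [h6]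
    ring
  linarith only [h2, h3, h4, h7]

/-- Positivity of nonnegative supersolutions spreads to all later times. A barrier supported in a
moving ball connects the two points, and stays below `w`. -/
theorem pos_of_pos_of_lt {n : ℕ} {β : Transversal n → ℝ → ℝ} {B : ℝ}
    (hB : ∀ y τ, |β y τ| ≤ B) {w : ℝ → Transversal n → ℝ → ℝ} (hw : IsRegular w)
    (hnn : ∀ s y τ, 0 ≤ w s y τ) {C : ℝ} (hC : 0 ≤ C)
    (hop : ∀ s y τ, frontOp β w s y τ ≤ C * w s y τ)
    {s₀ : ℝ} {y₀ : Transversal n} {τ₀ : ℝ} (hpos : 0 < w s₀ y₀ τ₀)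
    (s₁ : ℝ) (y₁ : Transversal n) {τ₁ : ℝ} (hτ : τ₀ < τ₁) : 0 < w s₁ y₁ τ₁ := by
  -- a ball on which `w` exceeds half of `w s₀ y₀ τ₀` at time `τ₀`
  obtain ⟨r, hr, hball⟩ : ∃ r > 0, ∀ s y, (s - s₀) ^ 2 + ‖y - y₀‖ ^ 2 ≤ r ^ 2 →
      w s₀ y₀ τ₀ / 2 < w s y τ₀ := by
    have hc : ContinuousAt (fun x : ℝ × Transversal n => w x.1 x.2 τ₀) (s₀, y₀) :=
      (hw.contDiff_space τ₀).continuous.continuousAt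
    obtain ⟨δ, hδ, h⟩ := Metric.eventually_nhds_iff.1 (hc.eventually_const_lt (half_lt_self hpos))
    refine ⟨δ / 2, half_pos hδ, fun s y hsy => h (y := (s, y)) ?_⟩
    have h1 : |s - s₀| ≤ δ / 2 := by
      refine abs_le_of_sq_le_sq ?_ (half_pos hδ).le
      linarith [sq_nonneg ‖y - y₀‖]
    have h2 : ‖y - y₀‖ ≤ δ / 2 := by
      refine (sq_le_sq₀ (norm_nonneg _) (half_pos hδ).le).1 ?_
      linarith [sq_nonneg (s - s₀)]
    rw [Prod.dist_eq, Real.dist_eq, dist_eq_norm]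
    exact max_lt (by linarith) (by linarith)
  set σ₁ := (s₁ - s₀) / (τ₁ - τ₀) with hσ₁
  set η₁ := (τ₁ - τ₀)⁻¹ • (y₁ - y₀) with hη₁
  have hτ' : τ₁ - τ₀ ≠ 0 := (sub_pos.2 hτ).ne'
  have hB0 : 0 ≤ B := (abs_nonneg _).trans (hB y₀ τ₀)
  -- `A` bounds the coefficient of `q = r² - |z|²`, and `α` makes `8r² - Aq + (α - C)q²` positive
  set A := 8 + 4 * (1 + (n - 1 : ℕ)) + 4 * B * r + 4 * r * (|σ₁| + ‖η₁‖) with hA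
  set α := C + A ^ 2 / r ^ 2 with hα
  set ε := w s₀ y₀ τ₀ / (2 * r ^ 4) with hε
  have hεpos : 0 < ε := by positivity
  set b := ballBarrier ε α r τ₀ s₀ σ₁ y₀ η₁ with hb
  have hbr : IsRegular b := isRegular_ballBarrier ..
  have hreg := hw.sub hbr
  let S : Set ((ℝ × Transversal n) × ℝ) := {p | p.2 ∈ Icc τ₀ τ₁ ∧
    (p.1.1 - (s₀ + (p.2 - τ₀) * σ₁)) ^ 2 + ‖p.1.2 - (y₀ + (p.2 - τ₀) • η₁)‖ ^ 2 ≤ r ^ 2}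
  have hdist : Continuous fun p : (ℝ × Transversal n) × ℝ =>
      (p.1.1 - (s₀ + (p.2 - τ₀) * σ₁)) ^ 2 + ‖p.1.2 - (y₀ + (p.2 - τ₀) • η₁)‖ ^ 2 := by
    fun_prop
  have hScl : IsClosed S :=
    (isClosed_Icc.preimage continuous_snd).inter (isClosed_le hdist continuous_const)
  have hScomp : IsCompact S := by
    let Φ : (ℝ × Transversal n) × ℝ → (ℝ × Transversal n) × ℝ := fun p =>
      ((p.1.1 + (s₀ + (p.2 - τ₀) * σ₁), p.1.2 + (y₀ + (p.2 - τ₀) • η₁)), p.2)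
    have hΦ : Continuous Φ := by fun_prop
    refine (((isCompact_closedBall ((0 : ℝ), (0 : Transversal n)) r).prod
      (isCompact_Icc (a := τ₀) (b := τ₁))).image hΦ).of_isClosed_subset hScl ?_
    rintro ⟨⟨s, y⟩, τ⟩ ⟨h1, h2⟩
    refine ⟨((s - (s₀ + (τ - τ₀) * σ₁), y - (y₀ + (τ - τ₀) • η₁)), τ), ⟨?_, h1⟩, by simp [Φ]⟩
    have hs : |s - (s₀ + (τ - τ₀) * σ₁)| ≤ r :=
      abs_le_of_sq_le_sq (by linarith only [h2, sq_nonneg ‖y - (y₀ + (τ - τ₀) • η₁)‖]) hr.le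
    have hy : ‖y - (y₀ + (τ - τ₀) • η₁)‖ ≤ r :=
      (sq_le_sq₀ (norm_nonneg _) hr.le).1
        (by linarith only [h2, sq_nonneg (s - (s₀ + (τ - τ₀) * σ₁))])
    exact mem_closedBall_zero_iff.2 (max_le hs hy)
  have e1 : s₁ - (s₀ + (τ₁ - τ₀) * σ₁) = 0 := by
    rw [hσ₁]
    field_simp
    ring
  have e2 : y₁ - (y₀ + (τ₁ - τ₀) • η₁) = 0 := by
    rw [hη₁, smul_inv_smul₀ hτ']
    abel
  have hS₁ : ((s₁, y₁), τ₁) ∈ S := by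
    refine ⟨⟨hτ.le, le_rfl⟩, ?_⟩
    simp only [e1, e2]
    simp
    positivity
  have hb₁ : 0 < b s₁ y₁ τ₁ := by
    rw [hb, ballBarrier, e1, e2]
    simp
    positivity
  obtain ⟨⟨⟨s, y⟩, τ⟩, ⟨hτI, hsy⟩, hmin⟩ := hScomp.exists_isMinOn ⟨_, hS₁⟩
    hreg.continuous.continuousOn
  have hmin' : ∀ p ∈ S, w s y τ - b s y τ ≤ w p.1.1 p.1.2 p.2 - b p.1.1 p.1.2 p.2 :=
    fun p hp => hmin hp
  have hmin₁ := hmin' _ hS₁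
  simp only at hτI hsy hmin₁
  by_contra! hw₁
  have hwb : w s y τ < b s y τ := by linarith only [hmin₁, hw₁, hb₁]
  set z := s - (s₀ + (τ - τ₀) * σ₁) with hz
  set ζ := y - (y₀ + (τ - τ₀) • η₁) with hζ
  set q := r ^ 2 - z ^ 2 - ‖ζ‖ ^ 2 with hq
  set E := ε * Real.exp (-α * (τ - τ₀)) with hE
  have hEpos : 0 < E := by positivity
  have hbval : b s y τ = E * q ^ 2 := by rw [hb, ballBarrier]
  have hq0 : 0 < q := by
    refine lt_of_le_of_ne (by linarith only [hq, hsy]) fun h => ?_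
    rw [hbval, ← h] at hwb
    linarith only [hwb, hnn s y τ]
  have hqr : q ≤ r ^ 2 := by
    rw [hq]
    linarith only [hq, sq_nonneg z, sq_nonneg ‖ζ‖]
  have hτ0 : τ₀ < τ := by
    refine lt_of_le_of_ne hτI.1 fun h => ?_
    have e1 : z = s - s₀ := by simp [hz, ← h]
    have e2 : ζ = y - y₀ := by simp [hζ, ← h]
    have h1 := hball s y (by rw [← e1, ← e2]; exact hsy)
    have h2 : E = ε := by simp [hE, ← h]
    have h3 : ε * q ^ 2 ≤ w s₀ y₀ τ₀ / 2 := by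
      calc ε * q ^ 2 ≤ ε * (r ^ 2) ^ 2 := by gcongr
        _ = w s₀ y₀ τ₀ / 2 := by
          rw [hε]
          field_simp
    rw [hbval, h2] at hwb
    rw [← h] at hwb
    linarith only [hwb, h1, h3]
  have hin : ∀ᶠ p : (ℝ × Transversal n) × ℝ in 𝓝 ((s, y), τ),
      (p.1.1 - (s₀ + (p.2 - τ₀) * σ₁)) ^ 2 + ‖p.1.2 - (y₀ + (p.2 - τ₀) • η₁)‖ ^ 2 < r ^ 2 :=
    (hdist.tendsto ((s, y), τ)).eventually_lt_const (by simp only; linarith only [hq, hq0])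
  have hopmin := frontOp_nonneg_of_min hreg β (s := s) (y := y) (τ := τ)
    (by
      have hc : ContinuousAt (fun x : ℝ × Transversal n => (x, τ)) (s, y) := by fun_prop
      filter_upwards [hc.eventually hin] with x hx
      exact hmin' (x, τ) ⟨hτI, hx.le⟩)
    (by
      have hc : ContinuousAt (fun t : ℝ => ((s, y), t)) τ := by fun_prop
      filter_upwards [(hc.eventually hin).filter_mono nhdsWithin_le_nhds, self_mem_nhdsWithin,
        (eventually_gt_nhds hτ0).filter_mono nhdsWithin_le_nhds] with t ht htτ ht0
      exact hmin' ((s, y), t) ⟨⟨ht0.le, (mem_Iio.1 htτ).le.trans hτI.2⟩, ht.le⟩)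
  rw [frontOp_sub hw hbr, hb,
    frontOp_ballBarrier β ε α r τ₀ s₀ σ₁ y₀ η₁ s y τ hz.symm hζ.symm hq.symm] at hopmin
  have hzr : |z| ≤ r := abs_le_of_sq_le_sq (by linarith only [hsy, sq_nonneg ‖ζ‖]) hr.le
  have hζr : ‖ζ‖ ≤ r := (sq_le_sq₀ (norm_nonneg _) hr.le).1 (by linarith only [hsy, sq_nonneg z])
  have hβz : β y τ * z ≤ B * r := by
    refine (le_abs_self _).trans ?_
    rw [abs_mul]
    exact mul_le_mul (hB y τ) hzr (abs_nonneg _) hB0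
  have hdrift : z * σ₁ + inner ℝ ζ η₁ ≤ r * (|σ₁| + ‖η₁‖) := by
    have h1 : z * σ₁ ≤ r * |σ₁| := by
      refine (le_abs_self _).trans ?_
      rw [abs_mul]
      gcongr
    have h2 : inner ℝ ζ η₁ ≤ r * ‖η₁‖ := (real_inner_le_norm _ _).trans (by gcongr)
    linarith only [h1, h2]
  have hkey := reaction_lt_barrier_coeff (C := C) (N := 1 + (n - 1 : ℕ)) hr hq0 hβz hdrift hA
  rw [← hα, show r ^ 2 - q = z ^ 2 + ‖ζ‖ ^ 2 by rw [hq]; ring] at hkey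
  have h1 := mul_lt_mul_of_pos_left hkey hEpos
  have h2 := mul_le_mul_of_nonneg_left hwb.le hC
  rw [hbval] at h2
  have h3 : frontOp β w s y τ ≤ E * (C * q ^ 2) :=
    (hop s y τ).trans (h2.trans_eq (by rw [mul_left_comm]))
  exact (sub_neg.2 (h3.trans_lt h1)).not_ge hopmin

/-- The strong maximum principle for time-periodic functions. -/
theorem eq_zero_or_pos {n : ℕ} {β : Transversal n → ℝ → ℝ} {B : ℝ}
    (hB : ∀ y τ, |β y τ| ≤ B) {w : ℝ → Transversal n → ℝ → ℝ} (hw : IsRegular w)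
    (htime : ∀ s y τ, w s y (τ + 1) = w s y τ)
    (hnn : ∀ s y τ, 0 ≤ w s y τ) {C : ℝ} (hC : 0 ≤ C)
    (hop : ∀ s y τ, frontOp β w s y τ ≤ C * w s y τ) :
    (∀ s y τ, w s y τ = 0) ∨ ∀ s y τ, 0 < w s y τ := by
  by_cases h : ∀ s y τ, w s y τ = 0
  · exact Or.inl h
  push Not at h
  obtain ⟨s₀, y₀, τ₀, h₀⟩ := h
  refine Or.inr fun s y τ => ?_
  obtain ⟨k, hk⟩ := exists_nat_gt (τ₀ - τ)
  have hper : Function.Periodic (w s y) 1 := fun t => htime s y t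
  have := pos_of_pos_of_lt hB hw hnn hC hop (lt_of_le_of_ne (hnn s₀ y₀ τ₀) h₀.symm) s y
    (τ₁ := τ + k) (by linarith)
  rwa [show τ + k = τ + k * 1 by ring, hper.nat_mul k τ] at this

/-! ### Sliding -/

/-- The sliding argument for a common drift: a subsolution is a translate of any supersolution. -/
theorem exists_eq_shift {n : ℕ} {f : ℝ → ℝ} (hf : IsCombustion f) {β : Transversal n → ℝ → ℝ}
    (hβc : Continuous (fun p : Transversal n × ℝ => β p.1 p.2)) (hβ : IsPeriodic β)
    {u u' : ℝ → Transversal n → ℝ → ℝ} (hu : IsFrontProfile u) (hu' : IsFrontProfile u')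
    (hsub : ∀ s y τ, 0 ≤ frontOp β u s y τ + f (u s y τ))
    (hsuper : ∀ s y τ, frontOp β u' s y τ + f (u' s y τ) ≤ 0) :
    ∃ l : ℝ, ∀ s y τ, u s y τ = u' (s + l) y τ := by
  obtain ⟨θ, hθ, hfθ, -⟩ := hf.cutoff
  obtain ⟨κ, hκ, hfκ⟩ := hf.exists_strictAntiOn hθ.2
  have hur := hu.regular.isRegular
  have hur' := hu'.regular.isRegular
  have hsuper' : ∀ l s y τ, frontOp β (fun s => u' (s + l)) s y τ + f (u' (s + l) y τ) ≤ 0 := by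
    intro l s y τ
    rw [frontOp_shift]
    exact hsuper (s + l) y τ
  -- `u` is below ignition for `s ≤ a₀`, and `u'` is close to `1` for `s ≥ b₀`
  obtain ⟨a₀, ha₀⟩ : ∃ a₀, ∀ s ≤ a₀, ∀ y τ, u s y τ ≤ θ := by
    obtain ⟨a, ha⟩ := eventually_atBot.1 (Metric.tendstoUniformly_iff.1 hu.tendsto_atBot θ hθ.1)
    refine ⟨a, fun s hs y τ => ?_⟩
    have := ha s hs (y, τ)
    rw [Real.dist_eq, abs_lt] at this
    linarith
  obtain ⟨b₀, hb₀⟩ : ∃ b₀, ∀ s ≥ b₀, ∀ y τ, κ ≤ u' s y τ := by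
    obtain ⟨b, hb⟩ := eventually_atTop.1
      (Metric.tendstoUniformly_iff.1 hu'.tendsto_atTop (1 - κ) (sub_pos.2 hκ.2))
    refine ⟨b, fun s hs y τ => ?_⟩
    have := hb s hs (y, τ)
    rw [Real.dist_eq, abs_lt] at this
    linarith
  let Λ : Set ℝ := {l | ∀ s y τ, u s y τ ≤ u' (s + l) y τ}
  have hne : Λ.Nonempty := by
    refine ⟨b₀ - a₀, fun s y τ => le_of_le_on_slab hfθ hfκ hβc hβ hu (hu'.shift (b₀ - a₀)) hsub
      (hsuper' _) ha₀ (b := a₀) (fun r hr => hb₀ _ (by linarith)) le_rfl ?_ s y τ⟩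
    intro r hr z t
    exact (ha₀ r hr.2 z t).trans (hκ.1.trans (hb₀ _ (by linarith [hr.1]) z t))
  have hbdd : BddBelow Λ := by
    obtain ⟨p, hp⟩ := eventually_atTop.1
      (Metric.tendstoUniformly_iff.1 hu.tendsto_atTop (1 / 2) (by norm_num))
    obtain ⟨q, hq⟩ := eventually_atBot.1
      (Metric.tendstoUniformly_iff.1 hu'.tendsto_atBot (1 / 2) (by norm_num))
    refine ⟨q - p, fun l hl => ?_⟩
    by_contra! hlt
    have h1 := hp p le_rfl (0, 0)
    have h2 := hq (p + l) (by linarith) (0, 0)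
    have h3 := hl p 0 0
    rw [Real.dist_eq, abs_lt] at h1 h2
    simp only at h1 h2
    linarith
  have hclosed : IsClosed Λ := by
    simp only [Λ, ofPred_forall]
    refine isClosed_iInter fun s => isClosed_iInter fun y => isClosed_iInter fun τ =>
      isClosed_le continuous_const ?_
    exact hur'.continuous.comp (f := fun l : ℝ => ((s + l, y), τ)) (by fun_prop)
  have hmem : sInf Λ ∈ Λ := hclosed.csInf_mem hne hbdd
  set l := sInf Λ with hl
  have hwr := (hur'.shift l).sub hur
  obtain ⟨B, hB⟩ := exists_abs_le_of_periodic hβc hβ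
  obtain ⟨C, hC⟩ := hf.contDiffOn.exists_lipschitzOnWith one_ne_zero (convex_Icc 0 1) isCompact_Icc
  have hop : ∀ s y τ, frontOp β (fun s y τ => u' (s + l) y τ - u s y τ) s y τ ≤
      C * (u' (s + l) y τ - u s y τ) := by
    intro s y τ
    rw [frontOp_sub (hur'.shift l) hur]
    have h1 := hC.dist_le_mul _ (hu'.mem_Icc (s + l) y τ) _ (hu.mem_Icc s y τ)
    rw [Real.dist_eq, Real.dist_eq, abs_of_nonneg (sub_nonneg.2 (hmem s y τ))] at h1
    linarith [hsub s y τ, hsuper' l s y τ, (abs_le.1 h1).1]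
  rcases eq_zero_or_pos hB hwr
    (fun s y τ => by rw [(hu'.periodic (s + l)).time, (hu.periodic s).time])
    (fun s y τ => sub_nonneg.2 (hmem s y τ)) C.2 hop with h0 | hpos
  · exact ⟨l, fun s y τ => (sub_eq_zero.1 (h0 s y τ)).symm⟩
  -- if `u' (· + l)` exceeds `u` strictly, slightly smaller shifts are still admissible.
  exfalso
  set b := max a₀ (b₀ - l + 1) with hbdef
  have hcompact : IsCompact ((Icc a₀ b ×ˢ (WithLp.toLp 2 '' (Icc (0 : Fin (n - 1) → ℝ) 1))) ×ˢ
      Icc (0 : ℝ) 1 : Set ((ℝ × Transversal n) × ℝ)) :=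
    (isCompact_Icc.prod (isCompact_cell n)).prod isCompact_Icc
  have hev := hcompact.eventually_forall_of_forall_eventually (x₀ := l)
    (P := fun m p => u p.1.1 p.1.2 p.2 < u' (p.1.1 + m) p.1.2 p.2) (by
      rintro ⟨⟨s, y⟩, τ⟩ -
      have h1 : Continuous fun z : ℝ × (ℝ × Transversal n) × ℝ => u z.2.1.1 z.2.1.2 z.2.2 :=
        hur.continuous.comp (f := fun z : ℝ × (ℝ × Transversal n) × ℝ => z.2) (by fun_prop)
      have h2 : Continuous fun z : ℝ × (ℝ × Transversal n) × ℝ =>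
          u' (z.2.1.1 + z.1) z.2.1.2 z.2.2 :=
        hur'.continuous.comp (f := fun z : ℝ × (ℝ × Transversal n) × ℝ =>
          ((z.2.1.1 + z.1, z.2.1.2), z.2.2)) (by fun_prop)
      exact h1.continuousAt.eventually_lt h2.continuousAt (sub_pos.1 (hpos s y τ)))
  obtain ⟨δ, hδ, hδev⟩ := Metric.eventually_nhds_iff.1 hev
  set m := l - min (δ / 2) 1 with hm
  have hmin0 : 0 < min (δ / 2) 1 := lt_min (half_pos hδ) one_pos
  have hdist : dist m l < δ := by
    rw [hm, Real.dist_eq, sub_sub_cancel_left, abs_neg, abs_of_pos hmin0]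
    linarith [min_le_left (δ / 2) 1]
  have hmΛ : m ∈ Λ := fun s y τ =>
    le_of_le_on_slab hfθ hfκ hβc hβ hu (hu'.shift m) hsub (hsuper' m) ha₀ (b := b)
      (fun r hr => hb₀ _ (by
        linarith [min_le_right (δ / 2) 1, le_max_right a₀ (b₀ - l + 1), ge_iff_le.1 hr]))
      (le_max_left _ _)
      (fun r hr z t => by
        obtain ⟨z', hz', t', ht', he⟩ := exists_mem_cell z t
        rw [he _ (hu.periodic r), he _ (hu'.periodic (r + m))]
        exact (hδev hdist ((r, z'), t') ⟨⟨hr, hz'⟩, ht'⟩).le) s y τ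
  linarith [csInf_le hbdd hmΛ]

end ShearFront

theorem theorem2p3 (n : ℕ) (hn : 2 ≤ n) (f : ℝ → ℝ) (hf : ShearFront.IsCombustion f)
    (β β' : ShearFront.Transversal n → ℝ → ℝ)
    (hβ_smooth : ContDiff ℝ ∞ (fun p : ShearFront.Transversal n × ℝ => β p.1 p.2))
    (hβ'_smooth : ContDiff ℝ ∞ (fun p : ShearFront.Transversal n × ℝ => β' p.1 p.2))
    (hβ_periodic : ShearFront.IsPeriodic β) (hβ'_periodic : ShearFront.IsPeriodic β')
    (hββ' : ∀ y τ, β y τ ≤ β' y τ)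
    (u u' : ℝ → ShearFront.Transversal n → ℝ → ℝ)
    (hu : ShearFront.IsFrontProfile u) (hu' : ShearFront.IsFrontProfile u')
    (hsub : ∀ s y τ, 0 ≤ ShearFront.frontOp β u s y τ + f (u s y τ))
    (hsuper : ∀ s y τ, ShearFront.frontOp β' u' s y τ + f (u' s y τ) ≤ 0)
    (hcases : (∀ y τ, β' y τ = β y τ) ∨ (∀ s y τ, 0 < ShearFront.dS u' s y τ) ∨
      (∀ s y τ, 0 < ShearFront.dS u s y τ)) :
    (∃ l : ℝ, ∀ s y τ, u s y τ = u' (s + l) y τ) ∧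
      ∃ (y₀ : ShearFront.Transversal n) (τ₀ : ℝ), β' y₀ τ₀ = β y₀ τ₀ := by
  have hc : Continuous (fun p : ShearFront.Transversal n × ℝ => β p.1 p.2) := hβ_smooth.continuous
  have hc' : Continuous (fun p : ShearFront.Transversal n × ℝ => β' p.1 p.2) :=
    hβ'_smooth.continuous
  rcases hcases with h | h | h
  · obtain rfl : β' = β := funext fun y => funext fun τ => h y τ
    exact ⟨ShearFront.exists_eq_shift hf hc hβ_periodic hu hu' hsub hsuper, 0, 0, rfl⟩
  · -- `u'` is a supersolution for the smaller drift `β` too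
    have hsuper' : ∀ s y τ, ShearFront.frontOp β u' s y τ + f (u' s y τ) ≤ 0 := fun s y τ => by
      have h1 := ShearFront.frontOp_eq_add_mul_dS β β' u' s y τ
      have h2 := mul_nonneg (sub_nonneg.2 (hββ' y τ)) (h s y τ).le
      linarith [hsuper s y τ]
    obtain ⟨l, hl⟩ := ShearFront.exists_eq_shift hf hc hβ_periodic hu hu' hsub hsuper'
    refine ⟨⟨l, hl⟩, 0, 0, le_antisymm ?_ (hββ' 0 0)⟩
    have hul : u = fun s => u' (s + l) := funext fun s => funext fun y => funext fun τ => hl s y τ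
    have h0 := hsub 0 0 0
    rw [hul, ShearFront.frontOp_shift] at h0
    have h1 := ShearFront.frontOp_eq_add_mul_dS β β' u' (0 + l) 0 0
    have h2 : (β' 0 0 - β 0 0) * ShearFront.dS u' (0 + l) 0 0 ≤ 0 := by
      linarith [hsuper (0 + l) 0 0]
    exact sub_nonpos.1 (nonpos_of_mul_nonpos_left h2 (h (0 + l) 0 0))
  · -- `u` is a subsolution for the larger drift `β'` too
    have hsub' : ∀ s y τ, 0 ≤ ShearFront.frontOp β' u s y τ + f (u s y τ) := fun s y τ => by
      have h1 := ShearFront.frontOp_eq_add_mul_dS β β' u s y τ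
      have h2 := mul_nonneg (sub_nonneg.2 (hββ' y τ)) (h s y τ).le
      linarith [hsub s y τ]
    obtain ⟨l, hl⟩ := ShearFront.exists_eq_shift hf hc' hβ'_periodic hu hu' hsub' hsuper
    refine ⟨⟨l, hl⟩, 0, 0, le_antisymm ?_ (hββ' 0 0)⟩
    have hul : u = fun s => u' (s + l) := funext fun s => funext fun y => funext fun τ => hl s y τ
    have h0 := hsuper (0 + l) 0 0
    rw [← ShearFront.frontOp_shift, ← hul, ← hl] at h0
    have h1 := ShearFront.frontOp_eq_add_mul_dS β β' u 0 0 0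
    have h2 : (β' 0 0 - β 0 0) * ShearFront.dS u 0 0 0 ≤ 0 := by
      linarith [hsub 0 0 0]
    exact sub_nonpos.1 (nonpos_of_mul_nonpos_left h2 (h 0 0 0))
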